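/- Theorem 2.12. Consider Bennett's pebble game on a board of $n\ge 1$ squares $s_1,\dots,s_n$, each of which is empty or contains one pebble. A move adds a pebble to an empty square or removes a pebble from an occupied square; a pebble may be added to or removed from $s_i$ only if $i=1$ or there is a pebble on $s_{i-1}$. A solution is a finite sequence of moves that leads from the empty board to the board with exactly one pebble, on $s_n$. Its time is its number of moves, and its space is the maximum number of pebbles on the board at any time. Let $F(n,S)$ be the minimum time of a solution with space at most $S$ ($\infty$ if there is none), and let $TS(n)=\min_{S\ge 1} F(n,S)\cdot S$ be the minimum time-space product. Then $TS(n)$ is finite for all $n\ge1$, and $$TS(n)=2^{2\sqrt{\log_2 n}\,(1+o(1))}\,n\qquad (n\to\infty),$$ that is, there is a function $\varepsilon:\mathbb N\to\mathbb R$ with $\varepsilon(n)\to 0$ as $n\to\infty$ such that $TS(n)=2^{2\sqrt{\log_2 n}\,(1+\varepsilon(n))}\,n$ for all $n\ge 1$. -/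

import Mathlib

/-- One move of the pebble game on the squares `1, …, n`, where a configuration is the finite set of
squares that carry a pebble: a pebble is added to the empty square `i`, or removed from the occupied
square `i`, and this is allowed only if `i = 1` or there is a pebble on square `i - 1`. -/
def PebbleMove (n : ℕ) (A B : Finset ℕ) : Prop :=
  ∃ i : ℕ, 1 ≤ i ∧ i ≤ n ∧ (i = 1 ∨ i - 1 ∈ A) ∧
    ((i ∉ A ∧ B = insert i A) ∨ (i ∈ A ∧ B = A.erase i))

/-- A solution of the pebble game on `n` squares: `time` moves lead from the empty board to the board
whose only pebble is on square `n`. `config t` is the configuration after `t` moves; its values for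
`t > time` play no role. -/
structure PebbleSolution (n : ℕ) where
  time : ℕ
  config : ℕ → Finset ℕ
  initial : config 0 = ∅
  move : ∀ t < time, PebbleMove n (config t) (config (t + 1))
  final : config time = {n}

/-- The number of pebbles used: the maximum number of pebbles on the board at any time. -/
def PebbleSolution.space {n : ℕ} (P : PebbleSolution n) : ℕ :=
  (Finset.range (P.time + 1)).sup fun t => (P.config t).card

/-- `F(n, S)`: the least number of steps of a solution on `n` squares that uses at most `S` pebbles,
and `∞` if there is no such solution. -/
noncomputable def pebbleF (n S : ℕ) : ℕ∞ :=
  ⨅ (P : PebbleSolution n) (_ : P.space ≤ S), (P.time : ℕ∞)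

/-- `TS(n)`: the minimum of `F(n, S) · S` over the numbers of pebbles `S ≥ 1`. -/
noncomputable def pebbleTS (n : ℕ) : ℕ∞ :=
  ⨅ (S : ℕ) (_ : 1 ≤ S), pebbleF n S * (S : ℕ∞)

/-!
With `L = log₂ n`, both directions show that `log₂ (TS(n) / n)` differs from `2 √L` by `O(1 + log L)`.

*Upper bound.* Cut the board into at most `k` blocks, pebble the ends of the blocks from left to right
and then remove all of them but the last from right to left, each block being treated recursively. With
`l` levels, any board of `n ≤ k ^ l` squares is solved with `l (k - 1) + 1` pebbles in
`(2 k - 1) ^ l` moves (`pebbleSolvable_of_le_pow`, from `PebblePath.append`). For `l ≈ √L` and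
`k ≈ n ^ (1 / l)` the product of time and space is about `2 ^ l * n * l * k`, with `log₂ k ≈ √L`.

*Lower bound.* For `n ≥ 2` there is an `M` with `1 ≤ M < n` and
`F(n, S) ≥ 2 F(M, S) + F(n - M, S - 1)` (`PebblePath.exists_split`). Here `M` is the highest position
that the lowest pebble takes while the essential part of the solution is running. The squares up to `M`
go from empty to a single pebble on `M` and back to empty, which are two solutions of the game on `M`
squares, the second one reversed; and they always hold a pebble, so the squares beyond `M` are solved
with `S - 1` pebbles. By induction
`F(n, S) ≥ 2 ^ l * (n - (l + S - 1).choose S)` for every `l` (`PebblePath.two_pow_mul_le`). The binomial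
coefficient is at most `(l + S) ^ l`, which is at most `n / 2` for `l ≈ L / log₂ (S + L)`. So
`log₂ (S * F(n, S) / n)` is at least about `log₂ S + L / log₂ S`, and the inequality between the arithmetic
and the geometric mean gives `2 √L`.
-/

/-! ### Paths of configurations -/

/-- `PebblePath n Q T A B`: there is a sequence of `T` legal moves of the game on `n` squares from the
configuration `A` to the configuration `B` such that every configuration visited, `A` and `B`
included, satisfies `Q`. -/
inductive PebblePath (n : ℕ) (Q : Finset ℕ → Prop) : ℕ → Finset ℕ → Finset ℕ → Prop
  | refl {A : Finset ℕ} : Q A → PebblePath n Q 0 A A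
  | step {T : ℕ} {A B C : Finset ℕ} :
      PebblePath n Q T A B → PebbleMove n B C → Q C → PebblePath n Q (T + 1) A C

theorem PebbleMove.symm {n : ℕ} {A B : Finset ℕ} (h : PebbleMove n A B) : PebbleMove n B A := by
  obtain ⟨i, h1, hn, hp, h⟩ := h
  refine ⟨i, h1, hn, ?_, ?_⟩
  · rcases hp with hp | hp
    · exact Or.inl hp
    · right
      rcases h with ⟨_, rfl⟩ | ⟨_, rfl⟩
      · exact Finset.mem_insert_of_mem hp
      · exact Finset.mem_erase.2 ⟨by omega, hp⟩
  · rcases h with ⟨h, rfl⟩ | ⟨h, rfl⟩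
    · exact Or.inr ⟨Finset.mem_insert_self _ _, (Finset.erase_insert h).symm⟩
    · exact Or.inl ⟨Finset.notMem_erase _ _, (Finset.insert_erase h).symm⟩

theorem PebbleMove.mono {m n : ℕ} (hmn : m ≤ n) {A B : Finset ℕ} (h : PebbleMove m A B) :
    PebbleMove n A B := by
  obtain ⟨i, h1, hn, hp, h⟩ := h
  exact ⟨i, h1, hn.trans hmn, hp, h⟩

namespace PebblePath

variable {n : ℕ} {Q : Finset ℕ → Prop} {T : ℕ} {A B : Finset ℕ}

theorem left (h : PebblePath n Q T A B) : Q A := by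
  induction h with
  | refl h => exact h
  | step _ _ _ ih => exact ih

theorem trans {T₁ T₂ : ℕ} {A B C : Finset ℕ} (h₁ : PebblePath n Q T₁ A B)
    (h₂ : PebblePath n Q T₂ B C) : PebblePath n Q (T₁ + T₂) A C := by
  induction h₂ with
  | refl _ => exact h₁
  | step _ hm hQ ih => exact (ih h₁).step hm hQ

theorem symm (h : PebblePath n Q T A B) : PebblePath n Q T B A := by
  induction h with
  | refl h => exact .refl h
  | @step T A B C h hm hQ ih =>
    rw [Nat.add_comm]
    exact ((PebblePath.refl hQ).step hm.symm ih.left).trans ih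

/-- A map of configurations that carries moves to moves carries paths to paths. -/
theorem map {n' : ℕ} {Q' : Finset ℕ → Prop} (f : Finset ℕ → Finset ℕ)
    (hf : ∀ A B, PebbleMove n A B → PebbleMove n' (f A) (f B)) (hQ : ∀ A, Q A → Q' (f A))
    (h : PebblePath n Q T A B) : PebblePath n' Q' T (f A) (f B) := by
  induction h with
  | refl h => exact .refl (hQ _ h)
  | step _ hm h ih => exact ih.step (hf _ _ hm) (hQ _ h)

theorem of_config {c : ℕ → Finset ℕ} {s t : ℕ} (hst : s ≤ t)
    (hm : ∀ u, s ≤ u → u < t → PebbleMove n (c u) (c (u + 1)))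
    (hQ : ∀ u, s ≤ u → u ≤ t → Q (c u)) : PebblePath n Q (t - s) (c s) (c t) := by
  induction t, hst using Nat.le_induction with
  | base => simpa using PebblePath.refl (n := n) (hQ s le_rfl le_rfl)
  | succ t hst ih =>
    rw [Nat.succ_sub hst]
    exact (ih (fun u h1 h2 => hm u h1 (by omega)) fun u h1 h2 => hQ u h1 (by omega)).step
      (hm t hst (by omega)) (hQ _ (by omega) le_rfl)

theorem exists_config (h : PebblePath n Q T A B) : ∃ c : ℕ → Finset ℕ, c 0 = A ∧ c T = B ∧
    (∀ t < T, PebbleMove n (c t) (c (t + 1))) ∧ ∀ t ≤ T, Q (c t) := by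
  induction h with
  | @refl A h => exact ⟨fun _ => A, rfl, rfl, by simp, fun _ _ => h⟩
  | @step T A B C _ hm hQ ih =>
    obtain ⟨c, h0, hT, hc, hQc⟩ := ih
    refine ⟨fun t => if t ≤ T then c t else C, by simp [h0], by simp, fun t ht => ?_,
      fun t ht => ?_⟩
    · rcases Nat.lt_succ_iff_lt_or_eq.1 ht with h | rfl
      · have h1 : t + 1 ≤ T := h
        simpa [h.le, h1] using hc t h
      · simpa [hT] using hm
    · by_cases h : t ≤ T
      · simpa [h] using hQc t h
      · simpa [h] using hQ

end PebblePath

/-! ### The recursive lower bound -/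

/-- The configuration seen by a player who looks only at the squares `1, …, M`. -/
def lowPart (M : ℕ) (A : Finset ℕ) : Finset ℕ := A.filter (· ≤ M)

/-- The configuration seen by a player who looks only at the squares beyond `M`, renumbered so that
square `M + 1` becomes square `1`. -/
def highPart (M : ℕ) (A : Finset ℕ) : Finset ℕ := (A.filter (M < ·)).image (· - M)

theorem mem_lowPart {M i : ℕ} {A : Finset ℕ} : i ∈ lowPart M A ↔ i ∈ A ∧ i ≤ M := by
  simp [lowPart]

theorem mem_highPart {M i : ℕ} {A : Finset ℕ} : i ∈ highPart M A ↔ 1 ≤ i ∧ i + M ∈ A := by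
  simp only [highPart, Finset.mem_image, Finset.mem_filter]
  constructor
  · rintro ⟨a, ⟨ha, hM⟩, rfl⟩
    exact ⟨by omega, by rwa [Nat.sub_add_cancel hM.le]⟩
  · rintro ⟨h1, h⟩
    exact ⟨i + M, ⟨h, by omega⟩, by omega⟩

theorem card_highPart_lt {M i : ℕ} {A : Finset ℕ} (hi : i ∈ A) (hM : i ≤ M) :
    (highPart M A).card < A.card :=
  Finset.card_image_le.trans_lt <| Finset.card_lt_card <|
    Finset.filter_ssubset.2 ⟨i, hi, not_lt.2 hM⟩

theorem PebbleMove.low_or_high {n M : ℕ} {A B : Finset ℕ} (h : PebbleMove n A B) :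
    (PebbleMove M (lowPart M A) (lowPart M B) ∧ highPart M A = highPart M B) ∨
      (PebbleMove (n - M) (highPart M A) (highPart M B) ∧ lowPart M A = lowPart M B) := by
  obtain ⟨i, h1, hn, hp, h⟩ := h
  rcases le_or_gt i M with hi | hi
  · refine Or.inl ⟨⟨i, h1, hi, hp.imp_right fun hp => mem_lowPart.2 ⟨hp, by omega⟩, ?_⟩, ?_⟩
    · rcases h with ⟨h, rfl⟩ | ⟨h, rfl⟩
      · refine Or.inl ⟨fun h' => h (mem_lowPart.1 h').1, ?_⟩
        ext j; simp only [mem_lowPart, Finset.mem_insert]; grind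
      · refine Or.inr ⟨mem_lowPart.2 ⟨h, hi⟩, ?_⟩
        ext j; simp only [mem_lowPart, Finset.mem_erase]; tauto
    · ext j
      rcases h with ⟨h, rfl⟩ | ⟨h, rfl⟩ <;>
        simp only [mem_highPart, Finset.mem_insert, Finset.mem_erase] <;> grind
  · obtain ⟨k, rfl⟩ : ∃ k, i = k + M := ⟨i - M, by omega⟩
    refine Or.inr ⟨⟨k, by omega, by omega, ?_, ?_⟩, ?_⟩
    · rcases Nat.lt_or_ge 1 k with hk | hk
      · refine Or.inr (mem_highPart.2 ⟨by omega, ?_⟩)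
        rcases hp with hp | hp
        · omega
        · rwa [show k - 1 + M = k + M - 1 by omega]
      · exact Or.inl (by omega)
    · rcases h with ⟨h, rfl⟩ | ⟨h, rfl⟩
      · refine Or.inl ⟨fun h' => h (mem_highPart.1 h').2, ?_⟩
        ext j; simp only [mem_highPart, Finset.mem_insert]; grind
      · refine Or.inr ⟨mem_highPart.2 ⟨by omega, h⟩, ?_⟩
        ext j; simp only [mem_highPart, Finset.mem_erase]; grind
    · ext j
      rcases h with ⟨h, rfl⟩ | ⟨h, rfl⟩ <;>
        simp only [mem_lowPart, Finset.mem_insert, Finset.mem_erase] <;> grind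

/-- Each move is made either on the first `M` squares or beyond them, so a path splits into two paths
whose lengths add up. -/
theorem PebblePath.split {n M T : ℕ} {Q Q₁ Q₂ : Finset ℕ → Prop} {A B : Finset ℕ}
    (h₁ : ∀ A, Q A → Q₁ (lowPart M A)) (h₂ : ∀ A, Q A → Q₂ (highPart M A))
    (h : PebblePath n Q T A B) : ∃ T₁ T₂, T₁ + T₂ = T ∧
      PebblePath M Q₁ T₁ (lowPart M A) (lowPart M B) ∧
      PebblePath (n - M) Q₂ T₂ (highPart M A) (highPart M B) := by
  induction h with
  | refl h => exact ⟨0, 0, rfl, .refl (h₁ _ h), .refl (h₂ _ h)⟩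
  | step _ hm hQ ih =>
    obtain ⟨T₁, T₂, hT, p₁, p₂⟩ := ih
    rcases hm.low_or_high (M := M) with ⟨hm, he⟩ | ⟨hm, he⟩
    · exact ⟨T₁ + 1, T₂, by omega, p₁.step hm (h₁ _ hQ), he ▸ p₂⟩
    · exact ⟨T₁, T₂ + 1, by omega, he ▸ p₁, p₂.step hm (h₂ _ hQ)⟩

theorem PebblePath.subset_Icc {n T : ℕ} {Q : Finset ℕ → Prop} {A B : Finset ℕ}
    (h : PebblePath n Q T A B) (hA : A ⊆ Finset.Icc 1 n) : B ⊆ Finset.Icc 1 n := by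
  induction h with
  | refl _ => exact hA
  | step _ hm _ ih =>
    obtain ⟨i, h1, hn, -, ⟨-, rfl⟩ | ⟨-, rfl⟩⟩ := hm
    · exact Finset.insert_subset (Finset.mem_Icc.2 ⟨h1, hn⟩) (ih hA)
    · exact (Finset.erase_subset _ _).trans (ih hA)

/-- The recursive lower bound `F(n, S) ≥ 2 F(M, S) + F(n - M, S - 1)` for some `1 ≤ M < n`. Here `M` is
the highest position of the lowest pebble between the first configuration `{n}` and the
last empty configuration before it: the squares up to `M` are pebbled and cleared again around the time where the
lowest pebble is on `M`, and during that whole period one pebble is on these squares, hence not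
available beyond `M`. -/
theorem PebblePath.exists_split {n s T : ℕ} (hn : 2 ≤ n)
    (h : PebblePath n (fun A => A.card ≤ s + 1) T ∅ {n}) :
    ∃ M T₁ T₂ T₃ r, 1 ≤ M ∧ M < n ∧ s = r + 1 ∧ T₁ + T₂ + T₃ ≤ T ∧
      PebblePath M (fun A => A.card ≤ s + 1) T₁ ∅ {M} ∧
      PebblePath M (fun A => A.card ≤ s + 1) T₂ ∅ {M} ∧
      PebblePath (n - M) (fun A => A.card ≤ r + 1) T₃ ∅ {n - M} := by
  classical
  obtain ⟨c, h0, hT, hc, hS⟩ := h.exists_config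
  have hex : ∃ t, c t = {n} := ⟨T, hT⟩
  obtain ⟨b, hb, hbmin⟩ : ∃ b, c b = {n} ∧ ∀ t < b, c t ≠ {n} :=
    ⟨Nat.find hex, Nat.find_spec hex, fun t ht => Nat.find_min hex ht⟩
  have hbT : b ≤ T := not_lt.1 fun hlt => hbmin T hlt hT
  obtain ⟨a, hab, ha, hamax⟩ : ∃ a ≤ b, c a = ∅ ∧ ∀ t, a < t → t ≤ b → c t ≠ ∅ :=
    ⟨Nat.findGreatest (fun t => c t = ∅) b, Nat.findGreatest_le _,
      Nat.findGreatest_spec (P := fun t => c t = ∅) (Nat.zero_le b) h0,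
      fun t h1 h2 => Nat.findGreatest_is_greatest h1 h2⟩
  have hab' : a < b := lt_of_le_of_ne hab <| by
    rintro rfl
    simp [ha] at hb
  have hab2 : a + 1 < b := by
    refine lt_of_le_of_ne hab' ?_
    rintro rfl
    obtain ⟨i, h1, hin, hp, h⟩ := hc a (by omega)
    rw [ha, hb] at h
    rw [ha] at hp
    have hi : i = 1 := by simpa using hp
    have : n = i := by simpa using h
    omega
  have hsub : ∀ t ≤ T, c t ⊆ Finset.Icc 1 n := fun t ht => by
    have hp : PebblePath n (fun _ => True) (t - 0) (c 0) (c t) :=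
      .of_config (Nat.zero_le t) (fun u _ hu => hc u (by omega)) fun _ _ _ => trivial
    exact hp.subset_Icc (by simp [h0])
  -- The configuration before the first `{n}` is nonempty, so it has a second pebble.
  obtain ⟨r, rfl⟩ : ∃ r, s = r + 1 := by
    refine ⟨s - 1, ?_⟩
    have hm := hc (b - 1) (by omega)
    have hne := hamax (b - 1) (by omega) (by omega)
    have hcard := hS (b - 1) (by omega)
    rw [Nat.sub_add_cancel (by omega), hb] at hm
    obtain ⟨i, -, -, -, ⟨hi, he⟩ | ⟨hi, he⟩⟩ := hm
    · have := congrArg Finset.card he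
      rw [Finset.card_singleton, Finset.card_insert_of_notMem hi] at this
      exact absurd (Finset.card_eq_zero.1 (by omega)) hne
    · have := congrArg Finset.card he
      rw [Finset.card_singleton, Finset.card_erase_of_mem hi] at this
      omega
  -- `M` is the highest position of the lowest pebble strictly between the times `a` and `b`.
  have hM : ∃ M, ∀ t, a < t → t < b → ∃ i ∈ c t, i ≤ M := by
    refine ⟨n, fun t h1 h2 => ?_⟩
    obtain ⟨i, hi⟩ := Finset.nonempty_iff_ne_empty.2 (hamax t h1 h2.le)
    exact ⟨i, hi, (Finset.mem_Icc.1 (hsub t (by omega) hi)).2⟩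
  obtain ⟨M, hMspec, hMmin⟩ : ∃ M, (∀ t, a < t → t < b → ∃ i ∈ c t, i ≤ M) ∧
      ∀ m < M, ¬ ∀ t, a < t → t < b → ∃ i ∈ c t, i ≤ m :=
    ⟨Nat.find hM, Nat.find_spec hM, fun m hm => Nat.find_min hM hm⟩
  have hM1 : 1 ≤ M := by
    obtain ⟨i, hi, hiM⟩ := hMspec (a + 1) (by omega) hab2
    have := (Finset.mem_Icc.1 (hsub (a + 1) (by omega) hi)).1
    omega
  obtain ⟨τ, haτ, hτb, hτ⟩ : ∃ τ, a < τ ∧ τ < b ∧ ∀ i ∈ c τ, M ≤ i := by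
    have := hMmin (M - 1) (by omega)
    push Not at this
    obtain ⟨τ, h1, h2, h⟩ := this
    exact ⟨τ, h1, h2, fun i hi => by have := h i hi; omega⟩
  obtain ⟨i, hiτ, hiM⟩ := hMspec τ haτ hτb
  obtain rfl : i = M := le_antisymm hiM (hτ i hiτ)
  -- If the lowest pebble were on square `n`, the configuration would be `{n}` before time `b`.
  have hin : i < n := by
    refine lt_of_le_of_ne (Finset.mem_Icc.1 (hsub τ (by omega) hiτ)).2 ?_
    rintro rfl
    refine hbmin τ hτb (Finset.eq_singleton_iff_unique_mem.2 ⟨hiτ, fun j hj => ?_⟩)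
    exact le_antisymm (Finset.mem_Icc.1 (hsub τ (by omega) hj)).2 (hτ j hj)
  have hlowτ : lowPart i (c τ) = {i} := by
    ext j
    rw [mem_lowPart, Finset.mem_singleton]
    refine ⟨fun h => le_antisymm h.2 (hτ j h.1), ?_⟩
    rintro rfl
    exact ⟨hiτ, le_rfl⟩
  let Q : Finset ℕ → Prop := fun A =>
    A.card ≤ r + 1 + 1 ∧ (A = ∅ ∨ A = {n} ∨ ∃ j ∈ A, j ≤ i)
  have hQ : ∀ t, a ≤ t → t ≤ b → Q (c t) := fun t h1 h2 => by
    refine ⟨hS t (by omega), ?_⟩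
    rcases h1.eq_or_lt with rfl | h1
    · exact Or.inl ha
    · rcases h2.eq_or_lt with rfl | h2
      · exact Or.inr (Or.inl hb)
      · exact Or.inr (Or.inr (hMspec t h1 h2))
  have hlow : ∀ A, Q A → (lowPart i A).card ≤ r + 1 + 1 := fun A hA =>
    (Finset.card_filter_le _ _).trans hA.1
  have hhigh : ∀ A, Q A → (highPart i A).card ≤ r + 1 := by
    rintro A ⟨hA, rfl | rfl | ⟨j, hj, hji⟩⟩
    · simp [highPart]
    · exact (Finset.card_image_le.trans (Finset.card_filter_le _ _)).trans (by simp)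
    · have := card_highPart_lt hj hji
      omega
  have p : PebblePath n Q (τ - a) (c a) (c τ) := .of_config haτ.le
    (fun u _ h => hc u (by omega)) fun u h1 h2 => hQ u h1 (by omega)
  have q : PebblePath n Q (b - τ) (c τ) (c b) := .of_config hτb.le
    (fun u _ h => hc u (by omega)) fun u h1 h2 => hQ u (by omega) h2
  obtain ⟨T₁, U₁, e₁, p₁, q₁⟩ :=
    p.split (Q₁ := fun A => A.card ≤ r + 1 + 1) (Q₂ := fun A => A.card ≤ r + 1) hlow hhigh
  obtain ⟨T₂, U₂, e₂, p₂, q₂⟩ :=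
    q.split (Q₁ := fun A => A.card ≤ r + 1 + 1) (Q₂ := fun A => A.card ≤ r + 1) hlow hhigh
  have hl0 : lowPart i ∅ = ∅ := by simp [lowPart]
  have hh0 : highPart i ∅ = ∅ := by simp [highPart]
  have hln : lowPart i {n} = ∅ := by
    ext j
    simp only [mem_lowPart, Finset.mem_singleton, Finset.notMem_empty, iff_false]
    omega
  have hhn : highPart i {n} = {n - i} := by
    ext j
    simp only [mem_highPart, Finset.mem_singleton]
    omega
  have q := q₁.trans q₂
  rw [ha, hlowτ, hl0] at p₁
  rw [hb, hlowτ, hln] at p₂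
  rw [ha, hb, hh0, hhn] at q
  exact ⟨i, T₁, T₂, U₁ + U₂, r, hM1, hin, rfl, by omega, p₁, p₂.symm, q⟩

/-- With `s + 1` pebbles, all but `(l + s).choose (s + 1)` of the squares cost `2 ^ l` moves on
average. The binomial coefficients come from Pascal's rule, applied to the recursive lower bound. -/
theorem PebblePath.two_pow_mul_le {n s T : ℕ} (hn : 1 ≤ n)
    (h : PebblePath n (fun A => A.card ≤ s + 1) T ∅ {n}) (l : ℕ) :
    2 ^ l * n ≤ T + 2 ^ l * (l + s).choose (s + 1) := by
  induction n using Nat.strong_induction_on generalizing s T l with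
  | _ n ih =>
    rcases hn.eq_or_lt with rfl | hn2
    · rcases l with _ | l
      · rcases T with _ | T
        · obtain ⟨c, h0, h1, -⟩ := h.exists_config
          simp [h0] at h1
        · simp
      · have : 0 < (l + 1 + s).choose (s + 1) := Nat.choose_pos (by omega)
        nlinarith [Nat.two_pow_pos (l + 1)]
    · obtain ⟨M, T₁, T₂, T₃, r, hM1, hMn, rfl, hT, p₁, p₂, p₃⟩ := h.exists_split hn2
      obtain ⟨k, rfl⟩ : ∃ k, n = M + k := ⟨n - M, by omega⟩
      rw [Nat.add_sub_cancel_left] at p₃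
      have i₁ := ih M hMn hM1 p₁
      have i₂ := ih M hMn hM1 p₂
      have i₃ := ih k (by omega) (by omega) p₃
      rcases l with _ | l
      · have j₁ := i₁ 0
        have j₃ := i₃ 0
        rw [Nat.choose_eq_zero_of_lt (by omega)] at j₁ j₃ ⊢
        omega
      · have j₁ := i₁ l
        have j₂ := i₂ l
        have j₃ := i₃ (l + 1)
        rw [show l + 1 + r = l + (r + 1) by omega] at j₃
        rw [show l + 1 + (r + 1) = l + (r + 1) + 1 by omega, Nat.choose_succ_succ, pow_succ]
        rw [pow_succ] at j₃
        nlinarith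

/-! ### Bennett's strategy -/

/-- Pebbling `m` squares, then `r` more while the pebble on square `m` stays, and then clearing the first
`m` squares by the reversed path solves the game on `m + r` squares with one more pebble. -/
theorem PebblePath.append {m r S T₁ T₂ : ℕ} (hm : 1 ≤ m) (hr : 1 ≤ r)
    (h₁ : PebblePath m (fun A => A.card ≤ S) T₁ ∅ {m})
    (h₂ : PebblePath r (fun A => A.card ≤ S) T₂ ∅ {r}) :
    PebblePath (m + r) (fun A => A.card ≤ S + 1) (T₁ + T₂ + T₁) ∅ {m + r} := by
  have p₁ : PebblePath (m + r) (fun A => A.card ≤ S + 1) T₁ ∅ {m} :=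
    h₁.map id (fun _ _ h => h.mono (Nat.le_add_right _ _)) fun _ h => Nat.le_succ_of_le h
  have p₂ := h₂.map (n' := m + r) (Q' := fun A => A.card ≤ S + 1)
    (fun A => insert m (A.image (· + m))) (by
      rintro A B ⟨i, h1, hi, hp, h⟩
      have hmem : ∀ C : Finset ℕ, i + m ∈ insert m (C.image (· + m)) ↔ i ∈ C := fun C => by
        simp only [Finset.mem_insert, Finset.mem_image]
        grind
      refine ⟨i + m, by omega, by omega, Or.inr ?_, ?_⟩
      · rcases hp with rfl | hp
        · rw [Nat.add_sub_cancel_left]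
          exact Finset.mem_insert_self _ _
        · exact Finset.mem_insert_of_mem (Finset.mem_image.2 ⟨i - 1, hp, by omega⟩)
      · rcases h with ⟨h, rfl⟩ | ⟨h, rfl⟩
        · refine Or.inl ⟨mt (hmem _).1 h, ?_⟩
          rw [Finset.image_insert, Finset.insert_comm]
        · refine Or.inr ⟨(hmem _).2 h, ?_⟩
          ext j
          simp only [Finset.mem_insert, Finset.mem_image, Finset.mem_erase]
          grind) (fun A hA => (Finset.card_insert_le _ _).trans
            (Nat.succ_le_succ (Finset.card_image_le.trans hA)))
  have p₃ := h₁.symm.map (n' := m + r) (Q' := fun A => A.card ≤ S + 1)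
    (fun A => insert (m + r) A) (by
      rintro A B ⟨i, h1, hi, hp, h⟩
      have hne : m + r ≠ i := by omega
      refine ⟨i, h1, by omega, hp.imp_right Finset.mem_insert_of_mem, ?_⟩
      rcases h with ⟨h, rfl⟩ | ⟨h, rfl⟩
      · refine Or.inl ⟨?_, Finset.insert_comm _ _ _⟩
        simp [h, hne.symm]
      · exact Or.inr ⟨Finset.mem_insert_of_mem h, (Finset.erase_insert_of_ne hne).symm⟩)
    (fun A hA => (Finset.card_insert_le _ _).trans (Nat.succ_le_succ hA))
  have e : (insert m ((({r} : Finset ℕ)).image (· + m)) : Finset ℕ) = insert (m + r) {m} := by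
    rw [Finset.image_singleton, Finset.pair_comm, Nat.add_comm]
  simp only [Finset.image_empty, insert_empty_eq, e] at p₂ p₃
  exact (p₁.trans p₂).trans p₃

/-- The game on `m` squares has a solution with at most `S` pebbles and at most `T` moves. -/
def PebbleSolvable (m S T : ℕ) : Prop :=
  ∃ T' ≤ T, PebblePath m (fun A => A.card ≤ S) T' ∅ {m}

theorem PebbleSolvable.mono {m S S' T T' : ℕ} (hS : S ≤ S') (hT : T ≤ T')
    (h : PebbleSolvable m S T) : PebbleSolvable m S' T' := by
  obtain ⟨U, hU, p⟩ := h
  exact ⟨U, hU.trans hT, p.map id (fun _ _ h => h) fun _ h => le_trans h hS⟩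

theorem pebbleSolvable_one : PebbleSolvable 1 1 1 :=
  ⟨1, le_rfl, .step (.refl (by simp)) ⟨1, le_rfl, le_rfl, Or.inl rfl, Or.inl ⟨by simp, by simp⟩⟩
    (by simp)⟩

theorem PebbleSolvable.of_blocks {c S T : ℕ} (h : ∀ m, 1 ≤ m → m ≤ c → PebbleSolvable m S T)
    (j m : ℕ) (h1 : 1 ≤ m) (hm : m ≤ (j + 1) * c) :
    PebbleSolvable m (S + j) ((2 * j + 1) * T) := by
  induction j generalizing m with
  | zero => simpa using h m h1 (by simpa using hm)
  | succ j ih =>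
    rcases le_or_gt m c with hmc | hmc
    · exact (h m h1 hmc).mono (Nat.le_add_right _ _) (Nat.le_mul_of_pos_left _ (by omega))
    · obtain ⟨r, rfl⟩ : ∃ r, m = c + r := ⟨m - c, by omega⟩
      have hc : 1 ≤ c := by
        by_contra hc
        obtain rfl : c = 0 := by omega
        omega
      have hr : r ≤ (j + 1) * c := by nlinarith
      obtain ⟨T₁, hT₁, p₁⟩ := (h c hc le_rfl).mono (Nat.le_add_right S j) le_rfl
      obtain ⟨T₂, hT₂, p₂⟩ := ih r (by omega) hr
      exact ⟨T₁ + T₂ + T₁, by nlinarith, p₁.append hc (by omega) p₂⟩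

/-- Bennett's strategy with `l` levels of `j + 1` blocks each. -/
theorem pebbleSolvable_of_le_pow (j l m : ℕ) (h1 : 1 ≤ m) (hm : m ≤ (j + 1) ^ l) :
    PebbleSolvable m (l * j + 1) ((2 * j + 1) ^ l) := by
  induction l generalizing m with
  | zero =>
    obtain rfl : m = 1 := by simp at hm; omega
    simpa using pebbleSolvable_one
  | succ l ih =>
    have := PebbleSolvable.of_blocks ih j m h1 (by rwa [pow_succ'] at hm)
    exact this.mono (by nlinarith) (by rw [pow_succ'])

/-! ### From paths to the time-space product -/

theorem PebbleSolution.path {n S : ℕ} (P : PebbleSolution n) (hP : P.space ≤ S) :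
    PebblePath n (fun A => A.card ≤ S) P.time ∅ {n} := by
  have := PebblePath.of_config (Q := fun A => A.card ≤ S) (Nat.zero_le P.time)
    (fun u _ hu => P.move u hu) fun u _ hu =>
      (Finset.le_sup (f := fun t => (P.config t).card)
        (Finset.mem_range.2 (Nat.lt_succ_of_le hu))).trans hP
  rwa [P.initial, P.final] at this

theorem PebbleSolvable.pebbleTS_le {n S T : ℕ} (hS : 1 ≤ S) (h : PebbleSolvable n S T) :
    pebbleTS n ≤ ((T * S : ℕ) : ℕ∞) := by
  obtain ⟨T', hT, p⟩ := h
  obtain ⟨c, h0, hc, hm, hQ⟩ := p.exists_config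
  let P : PebbleSolution n := ⟨T', c, h0, hm, hc⟩
  have hP : P.space ≤ S := Finset.sup_le fun t ht => hQ t (Nat.lt_succ_iff.1 (Finset.mem_range.1 ht))
  calc pebbleTS n ≤ pebbleF n S * S := iInf₂_le S hS
    _ ≤ (T : ℕ∞) * S := by
      gcongr
      exact (iInf₂_le P hP).trans (by exact_mod_cast hT)
    _ = _ := by push_cast; rfl

theorem exists_pebblePath_pebbleTS {n : ℕ} (h : pebbleTS n ≠ ⊤) :
    ∃ S T, 1 ≤ S ∧ PebblePath n (fun A => A.card ≤ S) T ∅ {n} ∧ (pebbleTS n).toNat = T * S := by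
  have hne : Nonempty {S : ℕ // 1 ≤ S} := ⟨⟨1, le_rfl⟩⟩
  obtain ⟨⟨S, hS⟩, he⟩ := ciInf_mem fun S : {S : ℕ // 1 ≤ S} => pebbleF n S * ((S : ℕ) : ℕ∞)
  have he : pebbleF n S * (S : ℕ∞) = pebbleTS n := by
    rw [pebbleTS, iInf_subtype']
    exact he
  have hF : pebbleF n S ≠ ⊤ := fun hF => h <| by
    rw [← he, hF, ENat.top_mul]
    exact_mod_cast (by omega : S ≠ 0)
  rw [pebbleF, iInf_subtype'] at hF
  have hne : Nonempty {P : PebbleSolution n // P.space ≤ S} := by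
    by_contra hemp
    rw [not_nonempty_iff] at hemp
    exact hF (iInf_of_empty _)
  obtain ⟨⟨P, hP⟩, hPe⟩ :=
    ciInf_mem fun P : {P : PebbleSolution n // P.space ≤ S} => ((P : PebbleSolution n).time : ℕ∞)
  have hPe : (P.time : ℕ∞) = pebbleF n S := by
    rw [pebbleF, iInf_subtype']
    exact hPe
  refine ⟨S, P.time, hS, P.path hP, ?_⟩
  rw [← he, ← hPe, ← Nat.cast_mul, ENat.toNat_natCast]

theorem pebbleTS_ne_top {n : ℕ} (hn : 1 ≤ n) : pebbleTS n ≠ ⊤ := by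
  have h := (pebbleSolvable_of_le_pow n 1 n hn (by simp)).pebbleTS_le (by simp)
  exact ne_top_of_le_ne_top (ENat.natCast_ne_top _) h

theorem pebbleTS_toNat_pos {n : ℕ} (hn : 1 ≤ n) : 0 < (pebbleTS n).toNat := by
  obtain ⟨S, T, hS, p, he⟩ := exists_pebblePath_pebbleTS (pebbleTS_ne_top hn)
  rcases T with _ | T
  · obtain ⟨c, h0, h1, -⟩ := p.exists_config
    simp [h0] at h1
  · rw [he]
    exact Nat.mul_pos T.succ_pos hS

/-! ### Asymptotics of the time-space product -/

/-- If the squares discarded in `PebblePath.two_pow_mul_le` are at most half of all, the other half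
costs `2 ^ l` moves per square. -/
theorem two_pow_mul_half_le {n s T l : ℕ} (hn : 1 ≤ n)
    (h : PebblePath n (fun A => A.card ≤ s + 1) T ∅ {n})
    (hl : ((l : ℝ) + (s + 1)) ^ l ≤ n / 2) : (2 : ℝ) ^ l * (n / 2) ≤ T := by
  have h1 : ((2 ^ l * n : ℕ) : ℝ) ≤ ((T + 2 ^ l * (l + s).choose (s + 1) : ℕ) : ℝ) :=
    Nat.cast_le.2 (h.two_pow_mul_le hn l)
  push_cast at h1
  have h2 : ((l + s).choose (s + 1) : ℝ) ≤ n / 2 := by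
    refine le_trans ?_ hl
    rcases l with _ | l
    · simp
    · have hc : (l + 1 + s).choose (s + 1) = (l + 1 + s).choose l :=
        Nat.choose_symm_of_eq_add (by omega)
      have hb : ((l + 1 + s).choose l : ℝ) ≤ ((l + 1 + s) ^ l : ℕ) :=
        Nat.cast_le.2 (Nat.choose_le_pow _ _)
      rw [hc]
      refine hb.trans ?_
      push_cast
      calc ((l : ℝ) + 1 + s) ^ l ≤ ((l : ℝ) + 1 + s) ^ (l + 1) :=
            pow_le_pow_right₀ (by linarith [Nat.cast_nonneg (α := ℝ) l, Nat.cast_nonneg (α := ℝ) s])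
              (Nat.le_succ l)
        _ ≤ _ := pow_le_pow_left₀ (by positivity) (by linarith) _
  nlinarith [mul_le_mul_of_nonneg_left h2 (show (0 : ℝ) ≤ 2 ^ l by positivity)]

open Real in
/-- The lower bound for the time-space product. The number `l` of
`two_pow_mul_half_le` is chosen as about `log₂ n / log₂ (S + log₂ n)`. -/
theorem logb_time_mul_space_ge {n S T : ℕ} (hn : 2 ≤ n) (hS : 1 ≤ S)
    (h : PebblePath n (fun A => A.card ≤ S) T ∅ {n}) :
    logb 2 n + 2 * √(logb 2 n) - 4 - logb 2 (1 + logb 2 n) ≤ logb 2 ((T * S : ℕ) : ℝ) := by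
  have hn0 : (0 : ℝ) < n := by positivity
  have hS1 : (1 : ℝ) ≤ S := by exact_mod_cast hS
  set L := logb 2 (n : ℝ) with hL
  have hL1 : 1 ≤ L := by
    rw [hL, Real.le_logb_iff_rpow_le one_lt_two hn0]
    simpa using (by exact_mod_cast hn : (2 : ℝ) ≤ n)
  set s := √L with hs
  have hs1 : 1 ≤ s := Real.one_le_sqrt.2 hL1
  have hss : s * s = L := Real.mul_self_sqrt (by linarith)
  set y := logb 2 (S + L) with hy
  have hy1 : 1 ≤ y := by
    rw [hy, Real.le_logb_iff_rpow_le one_lt_two (by linarith)]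
    norm_num; linarith
  have hyS : y ≤ logb 2 S + logb 2 (1 + L) := by
    rw [hy, ← Real.logb_mul (by linarith) (by linarith)]
    exact Real.logb_le_logb_of_le one_lt_two (by linarith) (by nlinarith)
  -- As `l ≤ L`, this choice gives `(l + S) ^ l ≤ (S + L) ^ l ≤ 2 ^ (L - 1) = n / 2`.
  set l := ⌊(L - 1) / y⌋₊ with hl
  have hl1 : (l : ℝ) ≤ (L - 1) / y := Nat.floor_le (div_nonneg (by linarith) (by linarith))
  have hl2 : (L - 1) / y < l + 1 := Nat.lt_floor_add_one _
  have hly : l * y ≤ L - 1 := (le_div_iff₀ (by linarith)).1 hl1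
  have hlL : (l : ℝ) ≤ L := by nlinarith [Nat.cast_nonneg (α := ℝ) l]
  have hT : (2 : ℝ) ^ l * (n / 2) ≤ T := by
    obtain ⟨r, rfl⟩ : ∃ r, S = r + 1 := ⟨S - 1, by omega⟩
    refine two_pow_mul_half_le (by omega) h ?_
    push_cast at hy hS1
    calc ((l : ℝ) + (r + 1)) ^ l ≤ (r + 1 + L) ^ l :=
          pow_le_pow_left₀ (by positivity) (by linarith) _
      _ = 2 ^ (l * y) := by
          rw [mul_comm, Real.rpow_mul zero_le_two, hy, Real.rpow_natCast,
            Real.rpow_logb two_pos (by norm_num) (by linarith)]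
      _ ≤ 2 ^ (L - 1) := Real.rpow_le_rpow_of_exponent_le one_le_two hly
      _ = n / 2 := by
          rw [Real.rpow_sub two_pos, Real.rpow_logb two_pos (by norm_num) hn0, Real.rpow_one]
  have hTS : (2 : ℝ) ^ l * (n / 2) * S ≤ ((T * S : ℕ) : ℝ) := by
    push_cast
    gcongr
  have hlog : l + (L - 1) + logb 2 S = logb 2 ((2 : ℝ) ^ l * (n / 2) * S) := by
    rw [Real.logb_mul (by positivity) (by positivity), Real.logb_mul (by positivity) (by positivity),
      Real.logb_div (by positivity) (by norm_num), Real.logb_pow,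
      Real.logb_self_eq_one one_lt_two, mul_one]
  have hmain := Real.logb_le_logb_of_le one_lt_two (by positivity) hTS
  rw [← hlog] at hmain
  -- The arithmetic-geometric mean inequality, with `s - 1 ≤ √(L - 1)`.
  have hamgm : 2 * (s - 1) ≤ (L - 1) / y + y := by
    rw [div_add' _ _ _ (by linarith), le_div_iff₀ (by linarith)]
    nlinarith [sq_nonneg (s - 1 - y)]
  linarith

open Real in
/-- The upper bound for the time-space product, from Bennett's strategy with `⌈√(log₂ n)⌉` levels. -/
theorem logb_pebbleTS_le {n : ℕ} (hn : 2 ≤ n) :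
    logb 2 ((pebbleTS n).toNat : ℝ) ≤
      logb 2 n + 2 * √(logb 2 n) + 9 + logb 2 (1 + logb 2 n) := by
  have hn0 : (0 : ℝ) < n := by positivity
  set L := logb 2 (n : ℝ) with hL
  have hL1 : 1 ≤ L := by
    rw [hL, Real.le_logb_iff_rpow_le one_lt_two hn0]
    simpa using (by exact_mod_cast hn : (2 : ℝ) ≤ n)
  set s := √L with hs
  have hs1 : 1 ≤ s := Real.one_le_sqrt.2 hL1
  have hss : s * s = L := Real.mul_self_sqrt (by linarith)
  set l := ⌈s⌉₊ with hl
  have hl1 : s ≤ l := Nat.le_ceil s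
  have hl2 : (l : ℝ) < s + 1 := Nat.ceil_lt_add_one (by linarith)
  have hl0 : (0 : ℝ) < l := by linarith
  have hl0' : 1 ≤ l := by exact_mod_cast hl0
  -- `x` is the `l`-th root of `n`, so blocks of `⌊x⌋₊ + 1` at each of `l` levels cover `n` squares.
  set x : ℝ := 2 ^ (L / l) with hx
  have hx0 : 0 < x := by positivity
  have hxl : x ^ l = n := by
    rw [hx, ← Real.rpow_natCast, ← Real.rpow_mul zero_le_two, div_mul_cancel₀ _ hl0.ne',
      Real.rpow_logb two_pos (by norm_num) hn0]
  have hLl : L / l ≤ s := by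
    rw [div_le_iff₀ hl0]
    nlinarith
  have hx1 : 1 + s / 4 ≤ x := by
    have h1 : s / 2 ≤ L / l := by
      rw [le_div_iff₀ hl0]
      nlinarith
    have h2 := Real.add_one_le_exp (log 2 * (L / l))
    rw [← Real.rpow_def_of_pos two_pos] at h2
    nlinarith [Real.log_two_gt_d9]
  set j := ⌊x⌋₊ with hj
  have hj1 : (j : ℝ) ≤ x := Nat.floor_le hx0.le
  have hj2 : x < j + 1 := Nat.lt_floor_add_one x
  have hnk : n ≤ (j + 1) ^ l := by
    have : (n : ℝ) ≤ ((j + 1 : ℕ) : ℝ) ^ l := by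
      rw [← hxl]
      push_cast
      exact pow_le_pow_left₀ hx0.le hj2.le l
    exact_mod_cast this
  have hle := (pebbleSolvable_of_le_pow j l n (by omega) hnk).pebbleTS_le (by simp)
  have hle' : (pebbleTS n).toNat ≤ (2 * j + 1) ^ l * (l * j + 1) := by
    have := ENat.toNat_le_toNat hle (ENat.natCast_ne_top _)
    rwa [ENat.toNat_natCast] at this
  have hle2 : ((pebbleTS n).toNat : ℝ) ≤ (2 * (x + 1)) ^ l * (l * (x + 1)) := by
    refine (Nat.cast_le.2 hle').trans ?_
    push_cast
    have : (1 : ℝ) ≤ l := by exact_mod_cast hl0'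
    exact mul_le_mul (pow_le_pow_left₀ (by positivity) (by linarith) l) (by nlinarith)
      (by positivity) (by positivity)
  have hpos : (0 : ℝ) < ((pebbleTS n).toNat : ℝ) := by
    exact_mod_cast pebbleTS_toNat_pos (n := n) (by omega)
  have hlog := Real.logb_le_logb_of_le one_lt_two hpos hle2
  rw [Real.logb_mul (by positivity) (by positivity), Real.logb_pow,
    Real.logb_mul (by positivity) (by positivity), Real.logb_mul (by positivity) (by positivity),
    Real.logb_self_eq_one one_lt_two] at hlog
  have hlogl : logb 2 (l : ℝ) ≤ logb 2 (1 + L) :=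
    Real.logb_le_logb_of_le one_lt_two hl0 (by nlinarith)
  have hlogx : logb 2 (x + 1) ≤ L / l + 2 / x := by
    have h1 : x + 1 = x * (1 + 1 / x) := by field_simp
    have h2 : logb 2 (1 + 1 / x) ≤ 2 / x := by
      rw [Real.logb, div_le_iff₀ (Real.log_pos one_lt_two)]
      have h3 := Real.log_le_sub_one_of_pos (show 0 < 1 + 1 / x by positivity)
      have h4 : 2 / x = 2 * (1 / x) := by ring
      rw [h4]
      nlinarith [Real.log_two_gt_d9, show 0 < 1 / x by positivity]
    rw [h1, Real.logb_mul hx0.ne' (by positivity)]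
    have h3 : logb 2 x = L / l := Real.logb_rpow two_pos (by norm_num)
    linarith
  -- Rounding `x` up costs only a constant factor in total, because `x` is at least of order `l`.
  have hsmall : (l + 1) * (2 / x) ≤ 8 := by
    rw [mul_div_assoc', div_le_iff₀ hx0]
    nlinarith
  have hmul : (l : ℝ) * (L / l) = L := mul_div_cancel₀ _ hl0.ne'
  nlinarith [mul_le_mul_of_nonneg_left hlogx (show (0 : ℝ) ≤ l + 1 by positivity)]

theorem pebbleTS_one : (pebbleTS 1).toNat = 1 := by
  have h := ENat.toNat_le_toNat (pebbleSolvable_one.pebbleTS_le le_rfl) (ENat.natCast_ne_top _)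
  rw [ENat.toNat_natCast] at h
  exact le_antisymm h (pebbleTS_toNat_pos le_rfl)

open Real Filter Topology in
/-- The error terms of both bounds are of smaller order than `√(log₂ n)`. -/
theorem tendsto_div_sqrt_logb :
    Tendsto (fun n : ℕ => (9 + logb 2 (1 + logb 2 n)) / (2 * √(logb 2 n))) atTop (𝓝 0) := by
  have hL : Tendsto (fun n : ℕ => logb 2 (n : ℝ)) atTop atTop :=
    (Real.tendsto_logb_atTop one_lt_two).comp tendsto_natCast_atTop_atTop
  have hs : Tendsto (fun y : ℝ => 9 / (2 * √y)) atTop (𝓝 0) :=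
    tendsto_const_nhds.div_atTop (Real.tendsto_sqrt_atTop.const_mul_atTop two_pos)
  have h1 : Tendsto (fun y : ℝ => logb 2 (1 + y) / (2 * √y)) atTop (𝓝 0) := by
    have hlo := (isLittleO_log_rpow_atTop (r := 1 / 2) (by norm_num)).tendsto_div_nhds_zero
    have hlo2 := (hlo.comp
      (tendsto_atTop_add_const_left atTop (1 : ℝ) tendsto_id)).const_mul (1 / log 2)
    rw [mul_zero] at hlo2
    refine squeeze_zero' ?_ ?_ hlo2
    · filter_upwards [eventually_ge_atTop 1] with y hy
      exact div_nonneg (Real.logb_nonneg one_lt_two (by linarith)) (by positivity)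
    · filter_upwards [eventually_ge_atTop 1] with y hy
      have hsq : √(1 + y) ≤ 2 * √y := by
        rw [Real.sqrt_le_left (by positivity), mul_pow, Real.sq_sqrt (by linarith)]
        linarith
      have hlog : 0 ≤ log (1 + y) := Real.log_nonneg (by linarith)
      have hsp : 0 < √(1 + y) := Real.sqrt_pos.2 (by linarith)
      have hl2 := Real.log_pos one_lt_two
      simp only [Function.comp, id, ← Real.sqrt_eq_rpow, Real.logb]
      rw [div_div, one_div_mul_eq_div, div_div, mul_comm (√(1 + y))]
      gcongr
  have := (hs.add h1).comp hL
  rw [add_zero] at this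
  refine this.congr fun n => ?_
  simp only [Function.comp]
  rw [← add_div]

theorem theorem2p12 :
    ∃ ε : ℕ → ℝ, Filter.Tendsto ε Filter.atTop (nhds 0) ∧
      ∀ n : ℕ, 1 ≤ n →
        pebbleTS n ≠ ⊤ ∧
        ((pebbleTS n).toNat : ℝ) =
          (2 : ℝ) ^ (2 * Real.sqrt (Real.logb 2 (n : ℝ)) * (1 + ε n)) * (n : ℝ) := by
  let ε : ℕ → ℝ := fun n =>
    (Real.logb 2 ((pebbleTS n).toNat : ℝ) - Real.logb 2 n - 2 * √(Real.logb 2 n)) /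
      (2 * √(Real.logb 2 n))
  refine ⟨ε, squeeze_zero_norm' ?_ tendsto_div_sqrt_logb, fun n hn => ⟨pebbleTS_ne_top hn, ?_⟩⟩
  · filter_upwards [Filter.eventually_ge_atTop 2] with n hn
    obtain ⟨S, T, hS, p, he⟩ := exists_pebblePath_pebbleTS (pebbleTS_ne_top (n := n) (by omega))
    have h1 := logb_time_mul_space_ge hn hS p
    have h2 := logb_pebbleTS_le hn
    rw [← he] at h1
    simp only [ε]
    rw [norm_div, Real.norm_eq_abs,
      Real.norm_of_nonneg (show 0 ≤ 2 * √(Real.logb 2 (n : ℝ)) by positivity)]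
    gcongr
    rw [abs_le]
    constructor <;> linarith
  · rcases hn.eq_or_lt with rfl | hn2
    -- The exponent vanishes at `n = 1`, so the formula holds there whatever `ε 1` is.
    · simp [pebbleTS_one]
    · have hn0 : (0 : ℝ) < n := by positivity
      have hL : 0 < Real.logb 2 (n : ℝ) := Real.logb_pos one_lt_two (by exact_mod_cast hn2)
      have hs : 0 < √(Real.logb 2 (n : ℝ)) := Real.sqrt_pos.2 hL
      have hpos : (0 : ℝ) < ((pebbleTS n).toNat : ℝ) := by
        exact_mod_cast pebbleTS_toNat_pos hn
      have he : 2 * √(Real.logb 2 (n : ℝ)) * (1 + ε n) =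
          Real.logb 2 ((pebbleTS n).toNat : ℝ) - Real.logb 2 n := by
        simp only [ε]
        field_simp
        ring
      rw [he, Real.rpow_sub two_pos, Real.rpow_logb two_pos (by norm_num) hpos,
        Real.rpow_logb two_pos (by norm_num) hn0, div_mul_cancel₀ _ hn0.ne']
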